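/- Let $K$ be a field and let $d,k,\ell$ be integers with $2\le k\le \ell\le d$. Put $\mathcal X=[d]$, $\mathcal Y=[k]\times[\ell]$, let $P=(p_{x,y})_{x\in\mathcal X,\,y\in\mathcal Y}$ be a matrix of indeterminates, and $R=K[p_{x,y}:x\in\mathcal X,\,y\in\mathcal Y]$. For $A\subseteq\mathcal X$, $B\subseteq\mathcal Y$ with $|A|=|B|$ let $[A|B]$ be the minor of $P$ with rows $A$ and columns $B$ (defined up to sign), and for a set $\Gamma$ of subsets of $\mathcal Y$ let $$J_{\mathcal X,\Gamma}=\langle [A|B] : A\subseteq\mathcal X,\ B\in\Gamma,\ |A|=|B|\rangle\subseteq R.$$ Let $R_i=\{i\}\times[\ell]$ for $i\in[k]$ and $C_j=[k]\times\{j\}$ for $j\in[\ell]$, and set $$\Lambda^2=\bigcup_{j\in[\ell]}\{B\subseteq C_j:|B|=2\},\qquad \Delta^{\ell}=\{B\subseteq\mathcal Y:|B|=\ell\},\qquad \Delta=\Delta^{2,\ell}=\Lambda^2\cup\bigcup_{i\in[k]}\{B\subseteq R_i:|B|=\ell\}.$$ Let $I_0=J_{\mathcal X,\Lambda^2\cup\Delta^\ell}$,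 and for $S\subseteq\mathcal Y$ let $I_S=\langle p_{x,y}:x\in\mathcal X,\ y\in S\rangle+J_{\mathcal X,\Lambda^2}$. Finally let $$\mathcal L=\{\{(i_1,j_1),\dots,(i_k,j_k)\}\subseteq\mathcal Y : |\{i_1,\dots,i_k\}|=k,\ |\{j_1,\dots,j_k\}|\ge 2\}.$$ Then $$\sqrt{J_{\mathcal X,\Delta}}=I_0\cap\bigcap_{S\in\mathcal L}I_S,$$ and this is a minimal prime decomposition: the ideals $I_0$ and $I_S$ $(S\in\mathcal L)$ are prime and pairwise distinct, none of them contains the intersection of the others (so they form a minimal primary decomposition of $\sqrt{J_{\mathcal X,\Delta}}$), and they are exactly the minimal primes of $J_{\mathcal X,\Delta}$. -/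

import Mathlib

noncomputable section

namespace HyperedgeIdeal

/-- The determinantal hyperedge ideal of a hypergraph `Δ` on the set `Y` of column indices of the
generic matrix `P = (p_{x,y})` over `K`: it is generated by the minors `[A|B]` with `A ⊆ X`,
`B ∈ Δ`, `|A| = |B|`.  The rows and the columns of a minor are listed by injections
`f : Fin n ↪ X` and `g : Fin n ↪ Y` with images `A` and `B`; another listing of the same rows
and columns only changes the sign of the minor. -/
def hyperedgeIdeal (K : Type*) [Field K] (X : Type*) {Y : Type*}
    (Δ : Set (Finset Y)) : Ideal (MvPolynomial (X × Y) K) :=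
  Ideal.span {q | ∃ (n : ℕ) (f : Fin n ↪ X) (g : Fin n ↪ Y),
    Finset.univ.map g ∈ Δ ∧ q = ((Matrix.mvPolynomialX X Y K).submatrix f g).det}

/-- The row `R_i = {(i, j) : j}` of the index set `Y = [k] × [ℓ]`. -/
def rowSet {k : ℕ} (ℓ : ℕ) (i : Fin k) : Finset (Fin k × Fin ℓ) :=
  Finset.univ.image fun j => (i, j)

/-- The column `C_j = {(i, j) : i}` of the index set `Y = [k] × [ℓ]`. -/
def colSet (k : ℕ) {ℓ : ℕ} (j : Fin ℓ) : Finset (Fin k × Fin ℓ) :=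
  Finset.univ.image fun i => (i, j)

/-- The hypergraph `Δ^t` of all `t`-subsets of `Y = [k] × [ℓ]`. -/
def allEdges (k ℓ t : ℕ) : Set (Finset (Fin k × Fin ℓ)) :=
  {B | B.card = t}

/-- The hypergraph `Λ^s` of all `s`-subsets of the columns `C_j`. -/
def colEdges (k ℓ s : ℕ) : Set (Finset (Fin k × Fin ℓ)) :=
  ⋃ j : Fin ℓ, {B | B ⊆ colSet k j ∧ B.card = s}

/-- The hypergraph `Δ^{s,t}`: all `s`-subsets of the columns `C_j` and all `t`-subsets of the
rows `R_i`. -/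
def ciEdges (k ℓ s t : ℕ) : Set (Finset (Fin k × Fin ℓ)) :=
  colEdges k ℓ s ∪ ⋃ i : Fin k, {B | B ⊆ rowSet ℓ i ∧ B.card = t}

/-- The ideal `I_0`, generated by the `s`-minors within the blocks `C_j` and all `t`-minors. -/
def idealZero (K : Type*) [Field K] (d k ℓ s t : ℕ) :
    Ideal (MvPolynomial (Fin d × (Fin k × Fin ℓ)) K) :=
  hyperedgeIdeal K (Fin d) (colEdges k ℓ s ∪ allEdges k ℓ t)

/-- The ideal `I_S`, generated by all variables in the columns of `P` indexed by `S` and the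
`s`-minors within the blocks `C_j`. -/
def idealOf (K : Type*) [Field K] (d k ℓ s : ℕ) (S : Finset (Fin k × Fin ℓ)) :
    Ideal (MvPolynomial (Fin d × (Fin k × Fin ℓ)) K) :=
  Ideal.span {q | ∃ (x : Fin d) (y : Fin k × Fin ℓ), y ∈ S ∧ q = MvPolynomial.X (x, y)} ⊔
    hyperedgeIdeal K (Fin d) (colEdges k ℓ s)

/-- The family `𝓛` of all sets `{(i_1, j_1), …, (i_k, j_k)}` with `|{i_1, …, i_k}| = k` and
`|{j_1, …, j_k}| ≥ 2`. -/
def transversals (k ℓ : ℕ) : Set (Finset (Fin k × Fin ℓ)) :=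
  {S | ∃ (i : Fin k → Fin k) (j : Fin k → Fin ℓ),
    (Finset.univ.image i).card = k ∧ 2 ≤ (Finset.univ.image j).card ∧
      S = Finset.univ.image fun m => (i m, j m)}

end HyperedgeIdeal

end

/-! Let `Q` be a prime containing the hyperedge ideal and work in the domain `R/Q`. Each block `C_j`
has rank at most one there. If some nonconstant `c : [k] → [ℓ]` has all columns `(m, c m)` zero,
then `Q` contains `I_S` for the graph `S` of `c`. Otherwise `Q` contains `I_0`. If some row `R_i`
has no zero column, every column `(i', j)` is a fraction-field multiple of `(i, j)`, so all
`ℓ`-minors with one column per block vanish with the minors of `R_i`. If every row has a zero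
column, any choice of these is constant, so an entire block vanishes and kills those minors. Minors
repeating a block already follow from the 2-minors (`exists_component_le`).

The components are prime because of the parametrization `p_{x,(i,j)} ↦ v_{x,j} w_{i,j}`. Its kernel
is generated by the 2-minors of the blocks, and killing the columns in `S` first gives `I_S` as a
kernel. `I_0` is the preimage of the ideal of maximal minors of the generic matrix `v`. That ideal
is prime because it consists of the polynomials vanishing on matrices with dependent columns, and
these matrices are parametrized by an affine space.

Explicit points and membership of variables show that the components are pairwise incomparable, so
they are the minimal primes. The decomposition follows since a radical is the intersection of the
minimal primes. -/

open MvPolynomial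

noncomputable section

namespace HyperedgeIdeal

/-! ### Primality of the ideal of maximal minors of a generic matrix -/

section MaximalMinors

variable {σ : Type*} {d l : ℕ}

/-- The ideal generated by the maximal minors (those using all columns) of a matrix of
variables. -/
def maxMinorIdeal (K : Type*) [CommRing K] (M : Fin d → Fin l → σ) : Ideal (MvPolynomial σ K) :=
  Ideal.span {q | ∃ f : Fin l → Fin d,
    q = (Matrix.of fun a j => (X (M (f a) j) : MvPolynomial σ K)).det}

/-- The columns of a matrix satisfy a nontrivial linear relation. -/
def HasKernel {L : Type*} [CommRing L] (N : Fin d → Fin l → L) : Prop :=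
  ∃ z : Fin l → L, z ≠ 0 ∧ ∀ a, ∑ j, N a j * z j = 0

variable {K L : Type*} [Field K] [Field L] [Algebra K L]

theorem polynomial_eq_zero_of_forall_ne [Infinite L] (G : Polynomial L) (b : L)
    (h : ∀ t, t ≠ b → G.eval t = 0) : G = 0 := by
  refine Polynomial.eq_zero_of_infinite_isRoot G ?_
  refine Set.Infinite.mono (s := {b}ᶜ) (fun t ht => h t ht) ?_
  exact (Set.finite_singleton b).infinite_compl

theorem eq_zero_of_forall_aeval_eq_zero [Infinite L] (f : MvPolynomial σ K)
    (h : ∀ p : σ → L, aeval p f = 0) : f = 0 := by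
  refine map_injective (algebraMap K L) (algebraMap K L).injective ?_
  rw [map_zero]
  refine MvPolynomial.funext fun p => ?_
  rw [map_zero, eval_map]
  exact h p

theorem algHom_eq_of_mem_supported {A : Type*} [CommRing A] [Algebra K A] {s : Set σ}
    {c : MvPolynomial σ K} (hc : c ∈ supported K s) (φ ψ : MvPolynomial σ K →ₐ[K] A)
    (h : ∀ i ∈ s, φ (X i) = ψ (X i)) : φ c = ψ c := by
  refine AlgHom.eqOn_adjoin_iff.2 (?_ : Set.EqOn φ ψ (X '' s)) hc
  rintro _ ⟨i, hi, rfl⟩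
  exact h i hi

theorem aeval_congr_of_mem_supported {v : σ} {c : MvPolynomial σ K}
    (hc : c ∈ supported K ({v}ᶜ : Set σ)) {p q : σ → L} (h : ∀ s, s ≠ v → p s = q s) :
    aeval p c = aeval q c :=
  algHom_eq_of_mem_supported hc _ _ fun i hi => by simpa using h i hi

theorem eval_aeval_line (p q : σ → L) (t : L) (c : MvPolynomial σ K) :
    Polynomial.eval t
      (aeval (fun s => Polynomial.C (p s) + Polynomial.X * Polynomial.C (q s)) c) =
      aeval (fun s => p s + t * q s) c := by
  induction c using MvPolynomial.induction_on with
  | C a => simp [← algebraMap_eq, Polynomial.algebraMap_apply]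
  | add f g hf hg => simp only [map_add, Polynomial.eval_add, hf, hg]
  | mul_X f s hf =>
    simp only [map_mul, aeval_X, Polynomial.eval_mul, hf, Polynomial.eval_add, Polynomial.eval_C,
      Polynomial.eval_X]

theorem X_mem_supported_compl {v s : σ} (h : s ≠ v) :
    (X s : MvPolynomial σ K) ∈ supported K ({v}ᶜ : Set σ) :=
  X_mem_supported.2 h

theorem det_mem_subalgebra {A n : Type*} [CommRing A] [Algebra K A] [Fintype n] [DecidableEq n]
    (S : Subalgebra K A) (N : Matrix n n A) (h : ∀ i j, N i j ∈ S) : N.det ∈ S := by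
  rw [Matrix.det_apply']
  exact sum_mem fun τ _ => mul_mem (intCast_mem S _) (prod_mem fun i _ => h _ _)

/-- Every polynomial is a polynomial in one chosen variable whose coefficients do not involve
that variable. -/
theorem exists_polynomial_eval_X (v : σ) (f : MvPolynomial σ K) :
    ∃ F : Polynomial (MvPolynomial σ K),
      (∀ i, F.coeff i ∈ supported K ({v}ᶜ : Set σ)) ∧ F.eval (X v) = f := by
  classical
  induction f using MvPolynomial.induction_on with
  | C a =>
    refine ⟨Polynomial.C (C a), fun i => ?_, by simp⟩
    rw [Polynomial.coeff_C]
    split_ifs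
    · exact (supported K ({v}ᶜ : Set σ)).algebraMap_mem a
    · exact zero_mem _
  | add f g hf hg =>
    obtain ⟨F, hF, rfl⟩ := hf
    obtain ⟨G, hG, rfl⟩ := hg
    exact ⟨F + G, fun i => by rw [Polynomial.coeff_add]; exact add_mem (hF i) (hG i), by simp⟩
  | mul_X f s hf =>
    obtain ⟨F, hF, rfl⟩ := hf
    by_cases hs : s = v
    · subst hs
      refine ⟨F * Polynomial.X, fun i => ?_, by simp⟩
      cases i with
      | zero => simp
      | succ i => rw [Polynomial.coeff_mul_X]; exact hF i
    · refine ⟨F * Polynomial.C (X s), fun i => ?_, by simp⟩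
      rw [Polynomial.coeff_mul_C]
      exact mul_mem (hF i) (X_mem_supported_compl hs)

theorem aeval_eq_zero_of_mem_maxMinorIdeal {M : Fin d → Fin l → σ} {f : MvPolynomial σ K}
    (hf : f ∈ maxMinorIdeal K M) {p : σ → L} (hp : HasKernel fun a j => p (M a j)) :
    aeval p f = 0 := by
  suffices h : maxMinorIdeal K M ≤ RingHom.ker (aeval p : MvPolynomial σ K →ₐ[K] L) from h hf
  refine Ideal.span_le.2 ?_
  rintro _ ⟨g, rfl⟩
  obtain ⟨z, hz, h⟩ := hp
  rw [SetLike.mem_coe, RingHom.mem_ker, AlgHom.map_det]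
  refine Matrix.exists_mulVec_eq_zero_iff.1 ⟨z, hz, ?_⟩
  ext a
  simpa [Matrix.mulVec, dotProduct] using h (g a)

/-- Degenerating a matrix with dependent columns along a curve: the leading coefficient in the
corner variable of a polynomial vanishing on such matrices. -/
theorem aeval_coeff_mul_pow_eq_zero [Infinite L] {M : Fin (d + 1) → Fin (l + 1) → σ}
    (hM : Function.Injective2 M) (c : ℕ → MvPolynomial σ K)
    (hc : ∀ i, c i ∈ supported K ({M 0 0}ᶜ : Set σ)) (n : ℕ)
    (hvan : ∀ p : σ → L, (HasKernel fun a j => p (M a j)) →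
      ∑ i ∈ Finset.range (n + 1), aeval p (c i) * p (M 0 0) ^ i = 0)
    (p : σ → L) (z : Fin l → L) (hz : z ≠ 0)
    (hp : ∀ a : Fin d, ∑ j : Fin l, p (M a.succ j.succ) * z j = 0) :
    aeval p (c n) * (∑ j : Fin l, p (M 0 j.succ) * z j) ^ n = 0 := by
  classical
  obtain ⟨j₀, hj₀⟩ := Function.ne_iff.1 hz
  rw [Pi.zero_apply] at hj₀
  set r := ∑ j : Fin l, p (M 0 j.succ) * z j with hr
  -- Subtracting `t * q` changes only column `j₀.succ` below row zero, by exactly what makes `(t,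
  -- z)` annihilate those rows; the corner value `-r / t` then handles row zero.
  let q : σ → L := Function.extend (fun a : Fin d => M a.succ j₀.succ)
    (fun a => p (M a.succ 0) / z j₀) 0
  have hq1 : ∀ a : Fin d, q (M a.succ j₀.succ) = p (M a.succ 0) / z j₀ := fun a =>
    Function.Injective.extend_apply (fun a b h => Fin.succ_injective _ (hM h).1) _ _ a
  have hq2 : ∀ a j, (a = 0 ∨ j ≠ j₀.succ) → q (M a j) = 0 := by
    intro a j h
    refine Function.extend_apply' _ _ _ ?_
    rintro ⟨b, hb⟩
    obtain ⟨h1, h2⟩ := hM hb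
    rcases h with h | h
    · exact Fin.succ_ne_zero _ (h1.trans h)
    · exact h h2.symm
  -- For `t ≠ 0` this is `t ^ n` times the given polynomial on the curve. It has no pole at `t = 0`,
  -- where only the term `i = n` survives.
  let G : Polynomial L := ∑ i ∈ Finset.range (n + 1),
    aeval (fun s => Polynomial.C (p s) + Polynomial.X * Polynomial.C (-q s)) (c i) *
      Polynomial.C ((-r) ^ i) * Polynomial.X ^ (n - i)
  have hGe : ∀ (t : L) (i : ℕ), Polynomial.eval t
      (aeval (fun s => Polynomial.C (p s) + Polynomial.X * Polynomial.C (-q s)) (c i)) =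
      aeval (fun s => p s - t * q s) (c i) := by
    intro t i
    rw [eval_aeval_line]
    simp only [mul_neg, ← sub_eq_add_neg]
  have hG : G = 0 := by
    refine polynomial_eq_zero_of_forall_ne G 0 fun t ht => ?_
    let P : σ → L := Function.update (fun s => p s - t * q s) (M 0 0) (-r / t)
    have hP0 : P (M 0 0) = -r / t := Function.update_self ..
    have hP1 : ∀ a j, (a ≠ 0 ∨ j ≠ 0) → P (M a j) = p (M a j) - t * q (M a j) := by
      intro a j h
      refine Function.update_of_ne (fun e => ?_) _ _
      obtain ⟨h1, h2⟩ := hM e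
      exact h.elim (fun h => h h1) (fun h => h h2)
    have hker : HasKernel fun a j => P (M a j) := by
      refine ⟨Fin.cons t z, fun h => ht (congrFun h 0), fun a => ?_⟩
      rw [Fin.sum_univ_succ]
      refine Fin.cases ?_ (fun a => ?_) a
      · simp only [Fin.cons_zero, Fin.cons_succ, hP0]
        rw [Finset.sum_congr rfl (g := fun j => p (M 0 j.succ) * z j), ← hr]
        · field_simp; ring
        · intro j _
          rw [hP1 _ _ (Or.inr (Fin.succ_ne_zero j)), hq2 _ _ (Or.inl rfl)]
          ring
      · simp only [Fin.cons_zero, Fin.cons_succ]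
        rw [hP1 _ _ (Or.inl (Fin.succ_ne_zero a)), hq2 _ _ (Or.inr (Fin.succ_ne_zero _).symm),
          Finset.sum_congr rfl (g := fun j => p (M a.succ j.succ) * z j -
            t * (q (M a.succ j.succ) * z j)), Finset.sum_sub_distrib, hp, ← Finset.mul_sum,
          Finset.sum_eq_single j₀, hq1]
        · field_simp; ring
        · intro j _ hj
          rw [hq2 _ _ (Or.inr fun h => hj (Fin.succ_injective _ h)), zero_mul]
        · simp
        · intro j _
          rw [hP1 _ _ (Or.inl (Fin.succ_ne_zero a))]
          ring
    have h := hvan P hker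
    rw [Polynomial.eval_finsetSum]
    have h2 : ∀ i ∈ Finset.range (n + 1), Polynomial.eval t
        (aeval (fun s => Polynomial.C (p s) + Polynomial.X * Polynomial.C (-q s)) (c i) *
          Polynomial.C ((-r) ^ i) * Polynomial.X ^ (n - i)) =
        t ^ n * (aeval P (c i) * P (M 0 0) ^ i) := by
      intro i hi
      have hi' : i ≤ n := Nat.lt_succ_iff.1 (Finset.mem_range.1 hi)
      rw [Polynomial.eval_mul, Polynomial.eval_mul, hGe,
        aeval_congr_of_mem_supported (hc i) (q := P)
          (fun s hs => (Function.update_of_ne hs _ _).symm), hP0]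
      simp only [Polynomial.eval_C, Polynomial.eval_pow, Polynomial.eval_X]
      rw [div_pow, ← Nat.sub_add_cancel hi', pow_add t (n - i) i, Nat.sub_add_cancel hi']
      field_simp
    rw [Finset.sum_congr rfl h2, ← Finset.mul_sum, h, mul_zero]
  have h0 : G.eval 0 = 0 := by rw [hG, Polynomial.eval_zero]
  rw [Polynomial.eval_finsetSum, Finset.sum_eq_single n] at h0
  · rw [Polynomial.eval_mul, Polynomial.eval_mul, hGe] at h0
    simp only [Nat.sub_self, pow_zero, Polynomial.eval_one, mul_one, Polynomial.eval_C, zero_mul,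
      sub_zero] at h0
    rw [neg_pow] at h0
    rcases mul_eq_zero.1 h0 with h | h
    · rw [h, zero_mul]
    · rcases mul_eq_zero.1 h with h | h
      · exact absurd h (pow_ne_zero _ (by simp))
      · rw [h, mul_zero]
  · intro i hi hin
    have : n - i ≠ 0 := by have := Finset.mem_range.1 hi; omega
    simp [this]
  · simp

/-- Bordering a smaller minor by row and column zero and expanding along column zero gives corner
variable times that minor plus terms free of the corner. This lets a leading coefficient be
cancelled inside the ideal. -/
theorem exists_lift_minor {M : Fin (d + 1) → Fin (l + 1) → σ} (hM : Function.Injective2 M)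
    {c : MvPolynomial σ K} (hc : c ∈ supported K ({M 0 0}ᶜ : Set σ))
    (h : c ∈ maxMinorIdeal K fun a j => M (Fin.succ a) (Fin.succ j)) :
    ∃ g ∈ maxMinorIdeal K M, ∃ r ∈ supported K ({M 0 0}ᶜ : Set σ), g = X (M 0 0) * c + r := by
  classical
  set S := supported K ({M 0 0}ᶜ : Set σ) with hS
  let θ : MvPolynomial σ K →ₐ[K] MvPolynomial σ K :=
    aeval fun s => if s = M 0 0 then 0 else X s
  have hθ : ∀ c ∈ S, θ c = c := fun c hc =>
    algHom_eq_of_mem_supported hc θ (AlgHom.id K _) fun i hi => by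
      have : i ≠ M 0 0 := hi
      simp [θ, this]
  have hθS : ∀ f, θ f ∈ S := by
    intro f
    induction f using MvPolynomial.induction_on with
    | C a => rw [← algebraMap_eq, AlgHom.commutes]; exact S.algebraMap_mem a
    | add f g hf hg => rw [map_add]; exact add_mem hf hg
    | mul_X f s hf =>
      rw [map_mul]
      refine mul_mem hf ?_
      simp only [θ, aeval_X]
      split_ifs with hs
      · exact zero_mem _
      · exact X_mem_supported_compl hs
  have hX : ∀ a j, (a ≠ 0 ∨ j ≠ 0) → (X (M a j) : MvPolynomial σ K) ∈ S := by
    intro a j h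
    refine X_mem_supported_compl fun e => ?_
    obtain ⟨h1, h2⟩ := hM e
    exact h.elim (fun h => h h1) (fun h => h h2)
  -- Coefficients arising in the span may involve the corner variable; `θ` sets it to zero, so the
  -- induction can run over the whole ideal.
  suffices H : ∃ g ∈ maxMinorIdeal K M, ∃ r ∈ S, g = X (M 0 0) * θ c + r by rwa [hθ c hc] at H
  clear hc
  refine Submodule.span_induction ?_ ?_ ?_ ?_ h
  · rintro _ ⟨f, rfl⟩
    set N : Matrix (Fin (l + 1)) (Fin (l + 1)) (MvPolynomial σ K) :=
      Matrix.of fun a j => X (M (Fin.cons (α := fun _ => Fin (d + 1)) 0 (fun i => (f i).succ) a) j)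
      with hN
    refine ⟨N.det, Ideal.subset_span ⟨_, rfl⟩,
      ∑ i : Fin l, (-1) ^ ((i.succ : Fin (l + 1)) : ℕ) * N i.succ 0 *
        (N.submatrix i.succ.succAbove Fin.succ).det, ?_, ?_⟩
    rotate_left
    · rw [Matrix.det_succ_column_zero, Fin.sum_univ_succ]
      congr 1
      rw [hθ]
      · simp only [Fin.val_zero, pow_zero, one_mul, Fin.succAbove_zero]
        rfl
      · exact det_mem_subalgebra _ _ fun i j => hX _ _ (Or.inl (Fin.succ_ne_zero _))
    · refine sum_mem fun i _ => mul_mem (mul_mem (pow_mem (neg_mem (one_mem _)) _) ?_) ?_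
      · exact hX _ _ (Or.inl (by simp))
      · exact det_mem_subalgebra _ _ fun i j => hX _ _ (Or.inr (Fin.succ_ne_zero _))
  · exact ⟨0, zero_mem _, 0, zero_mem _, by simp⟩
  · rintro x y - - ⟨g, hg, r, hr, e⟩ ⟨g', hg', r', hr', e'⟩
    exact ⟨g + g', add_mem hg hg', r + r', add_mem hr hr', by rw [e, e', map_add]; ring⟩
  · rintro a x - ⟨g, hg, r, hr, e⟩
    refine ⟨θ a * g, Ideal.mul_mem_left _ _ hg, θ a * r, mul_mem (hθS a) hr, ?_⟩
    rw [e, smul_eq_mul, map_mul]; ring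

/-- A polynomial vanishing on all matrices with dependent columns lies in the ideal of maximal
minors. -/
theorem mem_maxMinorIdeal_of_forall_hasKernel [Infinite L] {d l : ℕ} {M : Fin d → Fin l → σ}
    (hM : Function.Injective2 M) (f : MvPolynomial σ K)
    (hvan : ∀ p : σ → L, (HasKernel fun a j => p (M a j)) → aeval p f = 0) :
    f ∈ maxMinorIdeal K M := by
  classical
  -- Outer induction on the number of rows, inner induction on a degree bound in the corner
  -- variable.
  induction d generalizing l f with
  | zero =>
    cases l with
    | zero =>
      have : (1 : MvPolynomial σ K) ∈ maxMinorIdeal K M :=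
        Ideal.subset_span ⟨Fin.elim0, by simp⟩
      rw [(Ideal.eq_top_iff_one _).2 this]; trivial
    | succ l =>
      rw [eq_zero_of_forall_aeval_eq_zero (L := L) f fun p =>
        hvan p ⟨1, one_ne_zero, fun a => a.elim0⟩]
      exact zero_mem _
  | succ d ih =>
    cases l with
    | zero =>
      have : (1 : MvPolynomial σ K) ∈ maxMinorIdeal K M :=
        Ideal.subset_span ⟨Fin.elim0, by simp⟩
      rw [(Ideal.eq_top_iff_one _).2 this]; trivial
    | succ l =>
    obtain ⟨F, hF, hFf⟩ := exists_polynomial_eval_X (M 0 0) f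
    obtain ⟨n, hn⟩ : ∃ n, F.natDegree ≤ n := ⟨_, le_rfl⟩
    induction n generalizing F f with
    | zero =>
      have hf : f = F.coeff 0 := by
        rw [← hFf, Polynomial.eq_C_of_natDegree_le_zero hn]; simp
      have hfS : f ∈ supported K ({M 0 0}ᶜ : Set σ) := hf ▸ hF 0
      have hle : maxMinorIdeal K (fun a j => M (Fin.succ a) j) ≤ maxMinorIdeal K M := by
        refine Ideal.span_mono ?_
        rintro _ ⟨g, rfl⟩
        exact ⟨fun i => (g i).succ, rfl⟩
      refine hle (ih (fun a a' b b' h => ⟨Fin.succ_injective _ (hM h).1, (hM h).2⟩) f ?_)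
      rintro p ⟨z, hz, hp⟩
      -- Row zero is dropped, as `f` is free of the corner. If `z 0 ≠ 0`, the corner can be chosen
      -- to make `z` annihilate row zero too; if `z 0 = 0`, the degeneration with `n = 0` applies.
      by_cases hz0 : z 0 = 0
      · have := aeval_coeff_mul_pow_eq_zero hM F.coeff hF 0 (fun p hp => by
          simpa [← hf] using hvan p hp) p (fun j => z j.succ) (fun h => hz ?_) fun a => ?_
        · simpa [← hf] using this
        · ext j
          refine Fin.cases hz0 (fun j => congrFun h j) j
        · have := hp a
          rwa [Fin.sum_univ_succ, hz0, mul_zero, zero_add] at this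
      · rw [aeval_congr_of_mem_supported hfS (q := Function.update p (M 0 0)
          (-(∑ j : Fin l, p (M 0 j.succ) * z j.succ) / z 0))
          (fun s hs => (Function.update_of_ne hs _ _).symm)]
        refine hvan _ ⟨z, hz, fun a => ?_⟩
        have hne : ∀ a j, (a ≠ 0 ∨ j ≠ 0) → M a j ≠ M 0 0 := by
          intro a j h e
          obtain ⟨h1, h2⟩ := hM e
          exact h.elim (fun h => h h1) (fun h => h h2)
        refine Fin.cases ?_ (fun a => ?_) a
        · beta_reduce
          rw [Fin.sum_univ_succ, Function.update_self, div_mul_cancel₀ _ hz0, neg_add_eq_zero]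
          refine Finset.sum_congr rfl fun j _ => ?_
          rw [Function.update_of_ne (hne _ _ (Or.inr (Fin.succ_ne_zero j)))]
        · rw [← hp a]
          refine Finset.sum_congr rfl fun j _ => ?_
          beta_reduce
          rw [Function.update_of_ne (hne _ _ (Or.inl (Fin.succ_ne_zero a)))]
    | succ n ihn =>
      have hvan' : ∀ p : σ → L, (HasKernel fun a j => p (M a j)) →
          ∑ i ∈ Finset.range (n + 1 + 1), aeval p (F.coeff i) * p (M 0 0) ^ i = 0 := by
        intro p hp
        have := hvan p hp
        rw [← hFf, Polynomial.eval_eq_sum_range' (Nat.lt_succ_of_le hn), map_sum] at this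
        simpa using this
      have hlead : F.coeff (n + 1) ∈ maxMinorIdeal K fun a j => M (Fin.succ a) (Fin.succ j) := by
        refine ih (fun a a' b b' h => ⟨Fin.succ_injective _ (hM h).1,
          Fin.succ_injective _ (hM h).2⟩) _ ?_
        rintro p ⟨z, hz, hp⟩
        obtain ⟨j₀, hj₀⟩ := Function.ne_iff.1 hz
        rw [Pi.zero_apply] at hj₀
        -- The degeneration controls the leading coefficient only where the row-zero pairing with
        -- `z` is nonzero. Moving one entry of row zero makes it nonzero for all but one `t`, and a
        -- polynomial in `t` cannot see one exception.
        let G : Polynomial L := aeval (fun s => Polynomial.C (p s) +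
          Polynomial.X * Polynomial.C (if s = M 0 j₀.succ then 1 else 0)) (F.coeff (n + 1))
        have hGe : ∀ t, G.eval t =
            aeval (fun s => p s + t * if s = M 0 j₀.succ then 1 else 0) (F.coeff (n + 1)) :=
          fun t => eval_aeval_line _ _ t _
        have hG : G = 0 := by
          refine polynomial_eq_zero_of_forall_ne G
            (-(∑ j : Fin l, p (M 0 j.succ) * z j) / z j₀) fun t ht => ?_
          rw [hGe]
          have key := aeval_coeff_mul_pow_eq_zero hM F.coeff hF (n + 1) hvan'
            (fun s => p s + t * if s = M 0 j₀.succ then 1 else 0) z hz fun a => by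
              refine Eq.trans (Finset.sum_congr rfl fun j _ => ?_) (hp a)
              rw [if_neg fun e => Fin.succ_ne_zero _ (hM e).1, mul_zero, add_zero]
          refine (mul_eq_zero.1 key).resolve_right (pow_ne_zero _ fun h0 => ht ?_)
          rw [eq_div_iff hj₀, eq_neg_iff_add_eq_zero, ← h0, add_comm]
          simp only [add_mul, Finset.sum_add_distrib]
          congr 1
          rw [Finset.sum_eq_single j₀]
          · simp
          · intro j _ hj
            rw [if_neg fun e => hj (Fin.succ_injective _ (hM e).2)]
            ring
          · simp
        have := hGe 0
        rw [hG] at this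
        simpa using this.symm
      obtain ⟨g, hg, r, hr, e⟩ := exists_lift_minor hM (hF (n + 1)) hlead
      have hmem := Ideal.mul_mem_left (maxMinorIdeal K M) (X (M 0 0) ^ n) hg
      rw [← sub_add_cancel f (X (M 0 0) ^ n * g)]
      refine add_mem (ihn _ ?_ (F - (Polynomial.C (F.coeff (n + 1)) * Polynomial.X ^ (n + 1) +
        Polynomial.C r * Polynomial.X ^ n)) ?_ ?_ ?_) hmem
      · intro p hp
        rw [map_sub, hvan p hp, aeval_eq_zero_of_mem_maxMinorIdeal hmem hp, sub_zero]
      · intro i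
        rw [Polynomial.coeff_sub, Polynomial.coeff_add, Polynomial.coeff_C_mul_X_pow,
          Polynomial.coeff_C_mul_X_pow]
        refine sub_mem (hF i) (add_mem ?_ ?_)
        · split_ifs
          exacts [hF _, zero_mem _]
        · split_ifs
          exacts [hr, zero_mem _]
      · simp only [Polynomial.eval_sub, Polynomial.eval_add, Polynomial.eval_mul,
          Polynomial.eval_C, Polynomial.eval_pow, Polynomial.eval_X, hFf, e]
        ring
      · rw [Polynomial.natDegree_le_iff_coeff_eq_zero]
        intro N hN
        rw [Polynomial.coeff_sub, Polynomial.coeff_add, Polynomial.coeff_C_mul_X_pow,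
          Polynomial.coeff_C_mul_X_pow, if_neg (by omega : N ≠ n)]
        split_ifs with h
        · subst h; ring
        · rw [Polynomial.coeff_eq_zero_of_natDegree_lt (by omega)]; ring

/-- The ideal of maximal minors of a matrix of distinct variables is prime. -/
theorem maxMinorIdeal_isPrime {d l : ℕ} (hl : l ≠ 0) {M : Fin d → Fin l → σ}
    (hM : Function.Injective2 M) : (maxMinorIdeal K M).IsPrime := by
  classical
  let L := AlgebraicClosure K
  let τ := σ ⊕ (Fin l ⊕ Fin l)
  let z : Fin l → MvPolynomial τ K := fun j => X (Sum.inr (Sum.inl j))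
  let c : Fin l → MvPolynomial τ K := fun j => X (Sum.inr (Sum.inr j))
  let y : Fin d → Fin l → MvPolynomial τ K := fun a j => X (Sum.inl (M a j))
  -- Row `a` goes to `(c·z) y_a - (y_a·z) c`, which pairs to zero with `z`; clearing denominators in
  -- the projection along `c` keeps the target polynomial.
  let ψ : MvPolynomial σ K →ₐ[K] MvPolynomial τ K := aeval fun s =>
    if h : ∃ x : Fin d × Fin l, M x.1 x.2 = s then
      (∑ i, c i * z i) * y h.choose.1 h.choose.2 -
        (∑ i, y h.choose.1 i * z i) * c h.choose.2
    else X (Sum.inl s)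
  have hψ : ∀ a j, ψ (X (M a j)) = (∑ i, c i * z i) * y a j - (∑ i, y a i * z i) * c j := by
    intro a j
    have h : ∃ x : Fin d × Fin l, M x.1 x.2 = M a j := ⟨(a, j), rfl⟩
    obtain ⟨h1, h2⟩ := hM h.choose_spec
    simp only [ψ, aeval_X]
    rw [dif_pos h, h1, h2]
  have hψ' : ∀ s, (¬ ∃ x : Fin d × Fin l, M x.1 x.2 = s) → ψ (X s) = X (Sum.inl s) := by
    intro s hs
    simp only [ψ, aeval_X]
    rw [dif_neg hs]
  have hker : maxMinorIdeal K M = RingHom.ker ψ := by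
    refine le_antisymm (Ideal.span_le.2 ?_) fun f hf => ?_
    · rintro _ ⟨g, rfl⟩
      rw [SetLike.mem_coe, RingHom.mem_ker, AlgHom.map_det]
      refine Matrix.exists_mulVec_eq_zero_iff.1 ⟨z, fun h => ?_, ?_⟩
      · exact X_ne_zero _ (congrFun h ⟨0, Nat.pos_of_ne_zero hl⟩)
      · ext1 a
        simp only [Matrix.mulVec, dotProduct, AlgHom.mapMatrix_apply, Matrix.map_apply,
          Matrix.of_apply, hψ, Pi.zero_apply, sub_mul, Finset.sum_sub_distrib]
        simp only [mul_assoc, ← Finset.mul_sum]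
        ring
    · refine mem_maxMinorIdeal_of_forall_hasKernel (L := L) hM f ?_
      rintro p ⟨w, hw, hp⟩
      obtain ⟨j₀, hj₀⟩ := Function.ne_iff.1 hw
      rw [Pi.zero_apply] at hj₀
      -- Here `c·w = 1` and the rows of `p` already annihilate `w`, so the parametrization returns
      -- `p` itself.
      let P : τ → L := Sum.elim p (Sum.elim w (Pi.single j₀ (w j₀)⁻¹))
      have h1 : aeval P (ψ f) = 0 := by rw [(RingHom.mem_ker).1 hf, map_zero]
      rw [← h1]
      suffices h : aeval p = (aeval P : MvPolynomial τ K →ₐ[K] L).comp ψ from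
        DFunLike.congr_fun h f
      refine algHom_ext fun s => ?_
      rw [AlgHom.comp_apply]
      by_cases hs : ∃ x : Fin d × Fin l, M x.1 x.2 = s
      · obtain ⟨⟨a, j⟩, rfl⟩ := hs
        rw [hψ]
        simp only [y, z, c, map_sub, map_mul, map_sum, aeval_X, P, Sum.elim_inl, Sum.elim_inr]
        rw [hp a, Finset.sum_eq_single j₀]
        · simp [hj₀]
        · intro b _ hb
          simp [hb]
        · simp
      · rw [hψ' s hs]
        simp [P]
  rw [hker]
  exact RingHom.ker_isPrime _

end MaximalMinors

/-! ### Rank-one blocks: kernels and preimages under the parametrization -/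

section Segre

variable {K : Type*} [Field K] {d k ℓ : ℕ}

theorem minor_mem_hyperedgeIdeal {X Y : Type*} [DecidableEq Y] {Δ : Set (Finset Y)} {n : ℕ}
    (f : Fin n → X) (g : Fin n → Y)
    (hg : Function.Injective g → Finset.univ.image g ∈ Δ) :
    ((Matrix.mvPolynomialX X Y K).submatrix f g).det ∈ hyperedgeIdeal K X Δ := by
  by_cases hfi : Function.Injective f
  · by_cases hgi : Function.Injective g
    · refine Ideal.subset_span ⟨n, ⟨f, hfi⟩, ⟨g, hgi⟩, ?_, rfl⟩
      rw [Finset.map_eq_image]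
      exact hg hgi
    · obtain ⟨a, b, h, hab⟩ := Function.not_injective_iff.1 hgi
      rw [Matrix.det_zero_of_column_eq hab fun i => by simp [h]]
      exact zero_mem _
  · obtain ⟨a, b, h, hab⟩ := Function.not_injective_iff.1 hfi
    rw [Matrix.det_zero_of_row_eq hab (by ext i; simp [h])]
    exact zero_mem _

theorem hyperedgeIdeal_mono {X Y : Type*} {Δ Δ' : Set (Finset Y)} (h : Δ ⊆ Δ') :
    hyperedgeIdeal K X Δ ≤ hyperedgeIdeal K X Δ' := by
  refine Ideal.span_mono ?_
  rintro _ ⟨n, f, g, hg, rfl⟩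
  exact ⟨n, f, g, h hg, rfl⟩

/-- Column `(i, j)` becomes `w_{i,j}` times a vector depending only on `j`, so the scalars factor
out of the determinant. -/
theorem map_minor {A : Type*} [CommRing A] [Algebra K A]
    (χ : MvPolynomial (Fin d × (Fin k × Fin ℓ)) K →ₐ[K] A) (v : Fin d × Fin ℓ → A)
    (w : Fin k × Fin ℓ → A) (h : ∀ s, χ (X s) = v (s.1, s.2.2) * w s.2) {n : ℕ}
    (f : Fin n → Fin d) (g : Fin n → Fin k × Fin ℓ) :
    χ ((Matrix.mvPolynomialX (Fin d) (Fin k × Fin ℓ) K).submatrix f g).det =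
      (∏ b, w (g b)) * (Matrix.of fun a b => v (f a, (g b).2)).det := by
  rw [AlgHom.map_det, ← Matrix.det_mul_row]
  congr 1
  ext a b
  simp [h, mul_comm]

theorem map_minor_eq_zero {A : Type*} [CommRing A] [Algebra K A]
    (χ : MvPolynomial (Fin d × (Fin k × Fin ℓ)) K →ₐ[K] A) (v : Fin d × Fin ℓ → A)
    (w : Fin k × Fin ℓ → A) (h : ∀ s, χ (X s) = v (s.1, s.2.2) * w s.2) {n : ℕ}
    (f : Fin n → Fin d) (g : Fin n → Fin k × Fin ℓ)
    (hg : ¬ Function.Injective fun b => (g b).2) :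
    χ ((Matrix.mvPolynomialX (Fin d) (Fin k × Fin ℓ) K).submatrix f g).det = 0 := by
  obtain ⟨a, b, hab, hne⟩ := Function.not_injective_iff.1 hg
  rw [map_minor χ v w h, Matrix.det_zero_of_column_eq hne fun i => by simp [hab], mul_zero]

theorem hyperedgeIdeal_colEdges_le_ker {A : Type*} [CommRing A] [Algebra K A]
    (χ : MvPolynomial (Fin d × (Fin k × Fin ℓ)) K →ₐ[K] A) (v : Fin d × Fin ℓ → A)
    (w : Fin k × Fin ℓ → A) (h : ∀ s, χ (X s) = v (s.1, s.2.2) * w s.2) :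
    hyperedgeIdeal K (Fin d) (colEdges k ℓ 2) ≤ RingHom.ker χ := by
  refine Ideal.span_le.2 ?_
  rintro _ ⟨n, f, g, hg, rfl⟩
  obtain ⟨j, hj, hn⟩ := Set.mem_iUnion.1 hg
  rw [Finset.card_map, Finset.card_fin] at hn
  subst hn
  have hgj : ∀ a, (g a).2 = j := fun a => by
    have := hj (Finset.mem_map_of_mem g (Finset.mem_univ a))
    obtain ⟨i, -, hi⟩ := Finset.mem_image.1 this
    rw [← hi]
  refine map_minor_eq_zero χ v w h f g fun hi => ?_
  exact absurd (hi ((hgj 0).trans (hgj 1).symm)) (by decide)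

theorem two_minor_mem (x x' : Fin d) (i i' : Fin k) (j : Fin ℓ) :
    (X (x, (i', j)) * X (x', (i, j)) - X (x, (i, j)) * X (x', (i', j)) :
      MvPolynomial (Fin d × (Fin k × Fin ℓ)) K) ∈
      hyperedgeIdeal K (Fin d) (colEdges k ℓ 2) := by
  have := minor_mem_hyperedgeIdeal (K := K) (Δ := colEdges k ℓ 2) ![x, x'] ![(i', j), (i, j)]
    fun hg => by
      refine Set.mem_iUnion.2 ⟨j, fun y hy => ?_, ?_⟩
      · obtain ⟨a, -, rfl⟩ := Finset.mem_image.1 hy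
        rw [colSet, Finset.mem_image]
        fin_cases a
        · exact ⟨i', Finset.mem_univ _, rfl⟩
        · exact ⟨i, Finset.mem_univ _, rfl⟩
      · rw [Finset.card_image_of_injective _ hg, Finset.card_fin]
  rw [Matrix.det_fin_two] at this
  simpa using this

/-- The exponent map of the parametrization of tuples of rank-one blocks. -/
def segreExp (m : Fin d × (Fin k × Fin ℓ) →₀ ℕ) : (Fin d × Fin ℓ) ⊕ (Fin k × Fin ℓ) →₀ ℕ :=
  m.mapDomain (fun s => Sum.inl (s.1, s.2.2)) + m.mapDomain (fun s => Sum.inr s.2)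

theorem segreExp_add (m m' : Fin d × (Fin k × Fin ℓ) →₀ ℕ) :
    segreExp (m + m') = segreExp m + segreExp m' := by
  simp only [segreExp, Finsupp.mapDomain_add]
  abel

theorem segreExp_single (s : Fin d × (Fin k × Fin ℓ)) (n : ℕ) :
    segreExp (Finsupp.single s n) =
      Finsupp.single (Sum.inl (s.1, s.2.2)) n + Finsupp.single (Sum.inr s.2) n := by
  simp [segreExp, Finsupp.mapDomain_single]

theorem exists_of_segreExp_inl_ne_zero {m : Fin d × (Fin k × Fin ℓ) →₀ ℕ} {x : Fin d} {j : Fin ℓ}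
    (h : segreExp m (Sum.inl (x, j)) ≠ 0) : ∃ i, m (x, (i, j)) ≠ 0 := by
  classical
  contrapose! h
  rw [segreExp, Finsupp.add_apply]
  have h1 : m.mapDomain (fun s => (Sum.inl (s.1, s.2.2) : (Fin d × Fin ℓ) ⊕ (Fin k × Fin ℓ)))
      (Sum.inl (x, j)) = 0 := by
    refine Finsupp.notMem_support_iff.1 fun hs => ?_
    obtain ⟨⟨x', i', j'⟩, hm, e⟩ := Finset.mem_image.1 (Finsupp.mapDomain_support hs)
    simp only [Sum.inl.injEq, Prod.mk.injEq] at e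
    obtain ⟨rfl, rfl⟩ := e
    exact Finsupp.mem_support_iff.1 hm (h i')
  rw [h1, zero_add, Finsupp.mapDomain_of_notMem_range]
  rintro ⟨s, hs⟩
  cases hs

theorem exists_of_segreExp_inr_ne_zero {m : Fin d × (Fin k × Fin ℓ) →₀ ℕ} {y : Fin k × Fin ℓ}
    (h : segreExp m (Sum.inr y) ≠ 0) : ∃ x, m (x, y) ≠ 0 := by
  classical
  contrapose! h
  rw [segreExp, Finsupp.add_apply]
  have h1 : m.mapDomain (fun s => (Sum.inr s.2 : (Fin d × Fin ℓ) ⊕ (Fin k × Fin ℓ)))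
      (Sum.inr y) = 0 := by
    refine Finsupp.notMem_support_iff.1 fun hs => ?_
    obtain ⟨⟨x', y'⟩, hm, e⟩ := Finset.mem_image.1 (Finsupp.mapDomain_support hs)
    simp only [Sum.inr.injEq] at e
    subst e
    exact Finsupp.mem_support_iff.1 hm (h x')
  rw [h1, add_zero, Finsupp.mapDomain_of_notMem_range]
  rintro ⟨s, hs⟩
  cases hs

theorem exists_eq_single_add {σ : Type*} {m : σ →₀ ℕ} {s : σ} (h : m s ≠ 0) :
    ∃ m', m = Finsupp.single s 1 + m' := by
  classical
  refine ⟨m - Finsupp.single s 1, (add_tsub_cancel_of_le ?_).symm⟩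
  rw [Finsupp.single_le_iff]
  omega

variable (K d k ℓ) in
/-- The parametrization `p_{x,(i,j)} ↦ v_{x,j} w_{i,j}` of tuples of rank-one blocks. -/
def segreHom : MvPolynomial (Fin d × (Fin k × Fin ℓ)) K →ₐ[K]
    MvPolynomial ((Fin d × Fin ℓ) ⊕ (Fin k × Fin ℓ)) K :=
  aeval fun s => X (Sum.inl (s.1, s.2.2)) * X (Sum.inr s.2)

theorem segreHom_X (s : Fin d × (Fin k × Fin ℓ)) :
    segreHom K d k ℓ (X s) = X (Sum.inl (s.1, s.2.2)) * X (Sum.inr s.2) := by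
  rw [segreHom, aeval_X]

theorem segreHom_monomial (m : Fin d × (Fin k × Fin ℓ) →₀ ℕ) :
    segreHom K d k ℓ (monomial m 1) = monomial (segreExp m) 1 := by
  induction m using Finsupp.induction_linear with
  | zero => simp [segreExp]
  | add m m' hm hm' =>
    rw [segreExp_add, ← one_mul (1 : K), ← monomial_mul, ← monomial_mul, map_mul, hm, hm']
  | single s n =>
    rw [segreExp_single, ← X_pow_eq_monomial, map_pow, segreHom_X, mul_pow, X_pow_eq_monomial,
      X_pow_eq_monomial, monomial_mul, one_mul]

/-- Monomials with the same image under the parametrization are congruent modulo the 2-minors of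
the blocks. -/
theorem monomial_sub_monomial_mem (m m' : Fin d × (Fin k × Fin ℓ) →₀ ℕ)
    (h : segreExp m = segreExp m') :
    (monomial m 1 - monomial m' 1 : MvPolynomial (Fin d × (Fin k × Fin ℓ)) K) ∈
      hyperedgeIdeal K (Fin d) (colEdges k ℓ 2) := by
  induction hn : m.degree generalizing m m' with
  | zero =>
    rw [Finsupp.degree_eq_zero_iff] at hn
    subst hn
    have : m' = 0 := by
      by_contra hm'
      obtain ⟨s, hs⟩ := Finsupp.ne_iff.1 hm'
      obtain ⟨m₁, rfl⟩ := exists_eq_single_add hs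
      have := DFunLike.congr_fun h (Sum.inr s.2)
      rw [segreExp_add, segreExp_single] at this
      simp [segreExp] at this
      omega
    rw [this, sub_self]
    exact zero_mem _
  | succ n ih =>
    obtain ⟨⟨x, i, j⟩, hs⟩ : ∃ s, m s ≠ 0 := by
      by_contra! H
      rw [(Finsupp.ext H : m = 0)] at hn
      simp at hn
    obtain ⟨m₀, rfl⟩ := exists_eq_single_add hs
    have hdeg : m₀.degree = n := by
      rw [map_add, Finsupp.degree_single] at hn
      omega
    -- It is enough to move `m'`, modulo 2-minors, to a monomial sharing a variable with `m`;
    -- cancelling that variable lowers the degree. One exchange of rows between columns `(i', j)`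
    -- and `(i, j)` suffices.
    suffices H : ∃ m₁, segreExp m' = segreExp (Finsupp.single (x, (i, j)) 1 + m₁) ∧
        (monomial (Finsupp.single (x, (i, j)) 1 + m₁) 1 - monomial m' 1 :
          MvPolynomial (Fin d × (Fin k × Fin ℓ)) K) ∈
            hyperedgeIdeal K (Fin d) (colEdges k ℓ 2) by
      obtain ⟨m₁, h₁, h₂⟩ := H
      rw [h₁, segreExp_add, segreExp_add, add_right_inj] at h
      have h₃ := Ideal.mul_mem_left _ (monomial (Finsupp.single (x, (i, j)) 1) (1 : K))
        (ih m₀ m₁ h hdeg)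
      rw [mul_sub, monomial_mul, monomial_mul, one_mul] at h₃
      simpa using add_mem h₃ h₂
    have hx : segreExp m' (Sum.inl (x, j)) ≠ 0 := by
      rw [← h, segreExp_add, segreExp_single]
      simp
    have hi : segreExp m' (Sum.inr (i, j)) ≠ 0 := by
      rw [← h, segreExp_add, segreExp_single]
      simp
    obtain ⟨i', hi'⟩ := exists_of_segreExp_inl_ne_zero hx
    obtain ⟨x', hx'⟩ := exists_of_segreExp_inr_ne_zero hi
    obtain ⟨m₁, rfl⟩ := exists_eq_single_add hi'
    by_cases hii : i' = i
    · subst hii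
      exact ⟨m₁, rfl, by rw [sub_self]; exact zero_mem _⟩
    have hx'' : m₁ (x', (i, j)) ≠ 0 := by
      rw [Finsupp.add_apply, Finsupp.single_apply, if_neg (by simp [hii]), zero_add] at hx'
      exact hx'
    obtain ⟨m₂, rfl⟩ := exists_eq_single_add hx''
    refine ⟨Finsupp.single (x', (i', j)) 1 + m₂, ?_, ?_⟩
    · simp only [segreExp_add, segreExp_single]
      abel
    · have := Ideal.mul_mem_left _ (-monomial m₂ (1 : K)) (two_minor_mem (K := K) x x' i i' j)
      convert this using 1
      have e : ∀ a b : Fin d × (Fin k × Fin ℓ),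
          monomial (Finsupp.single a 1 + (Finsupp.single b 1 + m₂)) (1 : K) =
            X a * (X b * monomial m₂ 1) := by
        intro a b
        rw [X, X, monomial_mul, monomial_mul, one_mul, one_mul]
      rw [e, e]
      ring

variable (I : Ideal (MvPolynomial (Fin d × (Fin k × Fin ℓ)) K))

/-- The linear map sending the image of a monomial under `segreHom` to its class modulo `I`, and
all other monomials to zero. -/
def segreInv : MvPolynomial ((Fin d × Fin ℓ) ⊕ (Fin k × Fin ℓ)) K →ₗ[K]
    MvPolynomial (Fin d × (Fin k × Fin ℓ)) K ⧸ I :=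
  open Classical in
  (basisMonomials _ K).constr K fun n =>
    if h : ∃ m, segreExp m = n then Ideal.Quotient.mk I (monomial h.choose 1) else 0

theorem segreInv_monomial_of_not_exists {n : (Fin d × Fin ℓ) ⊕ (Fin k × Fin ℓ) →₀ ℕ}
    (h : ¬ ∃ m, segreExp m = n) : segreInv I (monomial n 1) = 0 := by
  have := (basisMonomials ((Fin d × Fin ℓ) ⊕ (Fin k × Fin ℓ)) K).constr_basis K
    (open Classical in fun n => if h : ∃ m, segreExp m = n then
      Ideal.Quotient.mk I (monomial h.choose 1) else 0) n
  rw [coe_basisMonomials, dif_neg h] at this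
  exact this

variable {I}

/-- The arbitrary choice of preimage monomial is harmless modulo `I`, as two choices differ by an
element of the 2-minor ideal. -/
theorem segreInv_segreHom (hI : hyperedgeIdeal K (Fin d) (colEdges k ℓ 2) ≤ I)
    (f : MvPolynomial (Fin d × (Fin k × Fin ℓ)) K) :
    segreInv I (segreHom K d k ℓ f) = Ideal.Quotient.mk I f := by
  induction f using MvPolynomial.induction_on' with
  | add f g hf hg => rw [map_add, map_add, map_add, hf, hg]
  | monomial m a =>
    have ha : monomial m a = a • (monomial m 1 : MvPolynomial (Fin d × (Fin k × Fin ℓ)) K) := by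
      rw [smul_monomial, smul_eq_mul, mul_one]
    rw [ha, map_smul, map_smul, ← Ideal.Quotient.mkₐ_eq_mk K, map_smul, segreHom_monomial]
    congr 1
    have h : ∃ m', segreExp m' = segreExp m := ⟨m, rfl⟩
    have := (basisMonomials ((Fin d × Fin ℓ) ⊕ (Fin k × Fin ℓ)) K).constr_basis K
      (open Classical in fun n => if h : ∃ m, segreExp m = n then
        Ideal.Quotient.mk I (monomial h.choose 1) else 0) (segreExp m)
    rw [coe_basisMonomials, dif_pos h] at this
    refine this.trans ?_
    exact Ideal.Quotient.eq.2 (hI (monomial_sub_monomial_mem _ _ h.choose_spec))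

theorem hyperedgeIdeal_colEdges_eq_ker :
    hyperedgeIdeal K (Fin d) (colEdges k ℓ 2) = RingHom.ker (segreHom K d k ℓ) := by
  refine le_antisymm (hyperedgeIdeal_colEdges_le_ker _ (fun s => X (Sum.inl s))
    (fun y => X (Sum.inr y)) segreHom_X) fun f hf => ?_
  rw [← Ideal.Quotient.eq_zero_iff_mem, ← segreInv_segreHom le_rfl, (RingHom.mem_ker).1 hf,
    map_zero]

theorem minor_mem_of_not_injective {n : ℕ} (f : Fin n → Fin d) (g : Fin n → Fin k × Fin ℓ)
    (hg : ¬ Function.Injective fun b => (g b).2) :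
    ((Matrix.mvPolynomialX (Fin d) (Fin k × Fin ℓ) K).submatrix f g).det ∈
      hyperedgeIdeal K (Fin d) (colEdges k ℓ 2) := by
  rw [hyperedgeIdeal_colEdges_eq_ker]
  exact map_minor_eq_zero _ (fun s => X (Sum.inl s)) (fun y => X (Sum.inr y)) segreHom_X f g hg

theorem idealOf_eq_ker (S : Finset (Fin k × Fin ℓ)) :
    idealOf K d k ℓ 2 S = RingHom.ker ((segreHom K d k ℓ).comp
      (aeval fun s => if s.2 ∈ S then 0 else X s)) := by
  refine le_antisymm (sup_le (Ideal.span_le.2 ?_) ?_) fun f hf => ?_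
  · rintro _ ⟨x, y, hy, rfl⟩
    simp [RingHom.mem_ker, hy]
  · refine hyperedgeIdeal_colEdges_le_ker _ (fun s => X (Sum.inl s))
      (fun y => if y ∈ S then 0 else X (Sum.inr y)) fun s => ?_
    rw [AlgHom.comp_apply, aeval_X]
    split_ifs
    · simp
    · exact segreHom_X s
  · let θ : MvPolynomial (Fin d × (Fin k × Fin ℓ)) K →ₐ[K]
      MvPolynomial (Fin d × (Fin k × Fin ℓ)) K := aeval fun s => if s.2 ∈ S then 0 else X s
    have h1 : θ f ∈ hyperedgeIdeal K (Fin d) (colEdges k ℓ 2) := by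
      rw [hyperedgeIdeal_colEdges_eq_ker]
      exact hf
    have h2 : ∀ f, f - θ f ∈ Ideal.span {q : MvPolynomial (Fin d × (Fin k × Fin ℓ)) K |
        ∃ (x : Fin d) (y : Fin k × Fin ℓ), y ∈ S ∧ q = MvPolynomial.X (x, y)} := by
      intro f
      induction f using MvPolynomial.induction_on with
      | C a => rw [← algebraMap_eq, AlgHom.commutes, sub_self]; exact zero_mem _
      | add f g hf hg => rw [map_add, add_sub_add_comm]; exact add_mem hf hg
      | mul_X f s hf =>
        rw [map_mul]
        simp only [θ, aeval_X]
        split_ifs with hs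
        · rw [mul_zero, sub_zero]
          exact Ideal.mul_mem_left _ _ (Ideal.subset_span ⟨s.1, s.2, hs, rfl⟩)
        · rw [← sub_mul]
          exact Ideal.mul_mem_right _ _ hf
    rw [← sub_add_cancel f (θ f)]
    exact add_mem (Ideal.mem_sup_left (h2 f)) (Ideal.mem_sup_right h1)

theorem idealOf_isPrime (S : Finset (Fin k × Fin ℓ)) : (idealOf K d k ℓ 2 S).IsPrime := by
  rw [idealOf_eq_ker]
  exact RingHom.ker_isPrime _

theorem minor_mem_idealZero (f : Fin ℓ → Fin d) (g : Fin ℓ → Fin k × Fin ℓ) :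
    ((Matrix.mvPolynomialX (Fin d) (Fin k × Fin ℓ) K).submatrix f g).det ∈
      idealZero K d k ℓ 2 ℓ :=
  minor_mem_hyperedgeIdeal f g fun hg => Or.inr <| by
    rw [allEdges, Set.mem_ofPred_eq, Finset.card_image_of_injective _ hg, Finset.card_fin]

/-- A monomial times a maximal minor of `v` either is the image of a monomial times an `ℓ`-minor of
`P`, or has no term in the image of the monomials. `segreInv` kills it in both cases. -/
theorem segreInv_idealZero_mul_det
    (a : MvPolynomial ((Fin d × Fin ℓ) ⊕ (Fin k × Fin ℓ)) K) (f : Fin ℓ → Fin d) :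
    segreInv (idealZero K d k ℓ 2 ℓ)
      (a * (Matrix.of fun b j => X (Sum.inl (f b, j))).det) = 0 := by
  classical
  have hI : hyperedgeIdeal K (Fin d) (colEdges k ℓ 2) ≤ idealZero K d k ℓ 2 ℓ :=
    hyperedgeIdeal_mono Set.subset_union_left
  induction a using MvPolynomial.induction_on' with
  | add a b ha hb => rw [add_mul, map_add, ha, hb, add_zero]
  | monomial n c =>
    have hc : monomial n c =
        c • (monomial n 1 : MvPolynomial ((Fin d × Fin ℓ) ⊕ (Fin k × Fin ℓ)) K) := by
      rw [smul_monomial, smul_eq_mul, mul_one]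
    rw [hc, smul_mul_assoc, map_smul]
    convert smul_zero c
    by_cases H : ∃ (π : Equiv.Perm (Fin ℓ)) (m : Fin d × (Fin k × Fin ℓ) →₀ ℕ),
        segreExp m = n + ∑ j, Finsupp.single (Sum.inl (f (π j), j)) 1
    · obtain ⟨π, m, hm⟩ := H
      have h1 : ∀ j, ∃ i, m (f (π j), (i, j)) ≠ 0 := fun j => by
        refine exists_of_segreExp_inl_ne_zero ?_
        rw [hm, ← Finset.add_sum_erase _ _ (Finset.mem_univ j)]
        simp
      choose i hi using h1
      -- The chosen variables lie in different blocks, hence are distinct, so their product divides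
      -- the monomial.
      have hle : ∑ j, Finsupp.single (f (π j), (i j, j)) 1 ≤ m := by
        rw [Finsupp.le_def]
        rintro ⟨x, i', j⟩
        rw [Finsupp.finsetSum_apply, Finset.sum_eq_single j]
        · rw [Finsupp.single_apply]
          split_ifs with e
          · rw [← e]
            exact Nat.one_le_iff_ne_zero.2 (hi j)
          · exact Nat.zero_le _
        · intro b _ hb
          rw [Finsupp.single_apply, if_neg]
          intro e
          exact hb (congrArg (fun s => s.2.2) e)
        · simp
      obtain ⟨m₀, rfl⟩ := exists_add_of_le hle
      have hsum : segreExp (∑ j, Finsupp.single (f (π j), (i j, j)) 1) =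
          ∑ j, Finsupp.single (Sum.inl (f (π j), j)) 1 +
            ∑ j, Finsupp.single (Sum.inr (i j, j)) 1 := by
        rw [← Finset.sum_add_distrib]
        let E : (Fin d × (Fin k × Fin ℓ) →₀ ℕ) →+ ((Fin d × Fin ℓ) ⊕ (Fin k × Fin ℓ) →₀ ℕ) :=
          ⟨⟨segreExp, by simp [segreExp]⟩, segreExp_add⟩
        refine (map_sum E _ _).trans (Finset.sum_congr rfl fun j _ => segreExp_single _ _)
      have hn : n = segreExp m₀ + ∑ j, Finsupp.single (Sum.inr (i j, j)) 1 := by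
        rw [segreExp_add, hsum] at hm
        refine add_right_cancel (hm.symm.trans ?_)
        abel
      have key : (monomial n 1 : MvPolynomial ((Fin d × Fin ℓ) ⊕ (Fin k × Fin ℓ)) K) *
          (Matrix.of fun b j => X (Sum.inl (f b, j))).det =
          segreHom K d k ℓ (monomial m₀ 1 * ((Matrix.mvPolynomialX (Fin d) (Fin k × Fin ℓ)
            K).submatrix f fun j => (i j, j)).det) := by
        rw [map_mul, map_minor _ (fun s => X (Sum.inl s)) (fun y => X (Sum.inr y)) segreHom_X,
          segreHom_monomial, ← mul_assoc, hn, ← one_mul (1 : K), ← monomial_mul, one_mul,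
          monomial_sum_one]
        rfl
      rw [key, segreInv_segreHom hI, Ideal.Quotient.eq_zero_iff_mem]
      exact Ideal.mul_mem_left _ _ (minor_mem_idealZero _ _)
    · push Not at H
      rw [Matrix.det_apply, Finset.mul_sum, map_sum]
      refine Finset.sum_eq_zero fun π _ => ?_
      rw [mul_smul_comm, Units.smul_def, map_zsmul]
      convert smul_zero _
      have : (∏ j, Matrix.of (fun b j => X (Sum.inl (f b, j))) (π j) j :
          MvPolynomial ((Fin d × Fin ℓ) ⊕ (Fin k × Fin ℓ)) K) =
          monomial (∑ j, Finsupp.single (Sum.inl (f (π j), j)) 1) 1 := by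
        rw [monomial_sum_one]
        rfl
      rw [this, monomial_mul, one_mul]
      exact segreInv_monomial_of_not_exists _ fun ⟨m, hm⟩ => H π m hm

/-- The hard inclusion applies `segreInv`, which kills the extended ideal of maximal minors and
inverts `segreHom` modulo `I_0`. -/
theorem idealZero_eq_comap : idealZero K d k ℓ 2 ℓ =
    (maxMinorIdeal K fun x j => Sum.inl (x, j)).comap (segreHom K d k ℓ) := by
  classical
  have hI : hyperedgeIdeal K (Fin d) (colEdges k ℓ 2) ≤ idealZero K d k ℓ 2 ℓ :=
    hyperedgeIdeal_mono Set.subset_union_left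
  refine le_antisymm (Ideal.span_le.2 ?_) fun f hf => ?_
  · rintro _ ⟨n, f, g, hg, rfl⟩
    rw [SetLike.mem_coe, Ideal.mem_comap]
    rcases hg with hg | hg
    · have : segreHom K d k ℓ ((Matrix.mvPolynomialX (Fin d) (Fin k × Fin ℓ) K).submatrix
          f g).det = 0 := by
        rw [← RingHom.mem_ker, ← hyperedgeIdeal_colEdges_eq_ker]
        exact Ideal.subset_span ⟨n, f, g, hg, rfl⟩
      rw [this]
      exact zero_mem _
    · rw [allEdges, Set.mem_ofPred_eq, Finset.card_map, Finset.card_fin] at hg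
      subst hg
      by_cases hinj : Function.Injective fun b => (g b).2
      · rw [map_minor _ (fun s => X (Sum.inl s)) (fun y => X (Sum.inr y)) segreHom_X]
        refine Ideal.mul_mem_left _ _ ?_
        let π : Equiv.Perm (Fin n) :=
          Equiv.ofBijective _ (Finite.injective_iff_bijective.1 hinj)
        have := Matrix.det_permute' π
          (Matrix.of fun a j => (X (Sum.inl (f a, j)) :
            MvPolynomial ((Fin d × Fin n) ⊕ (Fin k × Fin n)) K))
        refine (congrArg (· ∈ _) (?_ : _ = _)).mp (Ideal.mul_mem_left _
          ((Equiv.Perm.sign π : ℤ) : MvPolynomial ((Fin d × Fin n) ⊕ (Fin k × Fin n)) K)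
          (Ideal.subset_span ⟨f, rfl⟩))
        exact this.symm
      · rw [map_minor_eq_zero _ (fun s => X (Sum.inl s)) (fun y => X (Sum.inr y)) segreHom_X _ _
          hinj]
        exact zero_mem _
  · rw [← Ideal.Quotient.eq_zero_iff_mem, ← segreInv_segreHom hI]
    rw [Ideal.mem_comap] at hf
    suffices H : ∀ q ∈ (maxMinorIdeal K fun x j => Sum.inl (x, j) :
        Ideal (MvPolynomial ((Fin d × Fin ℓ) ⊕ (Fin k × Fin ℓ)) K)), ∀ a,
        segreInv (idealZero K d k ℓ 2 ℓ) (a * q) = 0 by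
      simpa using H _ hf 1
    intro q hq
    refine Submodule.span_induction ?_ ?_ ?_ ?_ hq
    · rintro _ ⟨g, rfl⟩ a
      exact segreInv_idealZero_mul_det a g
    · intro a
      rw [mul_zero, map_zero]
    · intro x y _ _ hx hy a
      rw [mul_add, map_add, hx, hy, add_zero]
    · intro b x _ hx a
      rw [smul_eq_mul, ← mul_assoc, hx]

theorem idealZero_isPrime (hℓ : ℓ ≠ 0) : (idealZero K d k ℓ 2 ℓ).IsPrime := by
  rw [idealZero_eq_comap]
  have : (maxMinorIdeal K fun (x : Fin d) (j : Fin ℓ) =>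
      (Sum.inl (x, j) : (Fin d × Fin ℓ) ⊕ (Fin k × Fin ℓ))).IsPrime :=
    maxMinorIdeal_isPrime hℓ fun a a' b b' h => by simpa using h
  exact Ideal.comap_isPrime _ _

end Segre

/-! ### Primes over the hyperedge ideal and incomparability of the components -/

section Decomposition

theorem minimalPrimes_eq_of_antichain {R : Type*} [CommRing R] {I : Ideal R} {A : Set (Ideal R)}
    (hprime : ∀ P ∈ A, P.IsPrime) (hle : ∀ P ∈ A, I ≤ P)
    (hex : ∀ Q : Ideal R, Q.IsPrime → I ≤ Q → ∃ P ∈ A, P ≤ Q)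
    (hanti : ∀ P ∈ A, ∀ P' ∈ A, P ≤ P' → P = P') : I.minimalPrimes = A := by
  ext P
  constructor
  · rintro ⟨⟨hP, hIP⟩, hmin⟩
    obtain ⟨P', hP', h⟩ := hex P hP hIP
    rwa [le_antisymm (hmin ⟨hprime P' hP', hle P' hP'⟩ h) h]
  · intro hP
    refine ⟨⟨hprime P hP, hle P hP⟩, fun Q hQ hQP => ?_⟩
    obtain ⟨P', hP', h⟩ := hex Q hQ.1 hQ.2
    rwa [← hanti P' hP' P hP (h.trans hQP)]

theorem radical_colon_univ_eq_of_isPrime {R : Type*} [CommRing R] {P : Ideal R} (hP : P.IsPrime) :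
    (Submodule.colon P (Set.univ : Set R)).radical = P := by
  have : Submodule.colon P (Set.univ : Set R) = P := by
    ext r
    rw [Submodule.mem_colon]
    refine ⟨fun h => by simpa using h 1 trivial, fun h x _ => ?_⟩
    exact Ideal.mul_mem_right _ _ h
  rw [this, hP.radical]

theorem isMinimalPrimaryDecomposition_of_antichain {R : Type*} [CommRing R] {I : Ideal R}
    {t : Finset (Ideal R)} (hI : t.inf id = I) (hprime : ∀ P ∈ t, P.IsPrime)
    (hanti : ∀ P ∈ t, ∀ P' ∈ t, P ≤ P' → P = P') :
    Submodule.IsMinimalPrimaryDecomposition I t where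
  inf_eq := hI
  primary P hP := (hprime P hP).isPrimary
  distinct P hP P' hP' hne h := hne <| by
    simpa only [radical_colon_univ_eq_of_isPrime (hprime P hP),
      radical_colon_univ_eq_of_isPrime (hprime P' hP')] using h
  minimal P hP h := by
    classical
    obtain ⟨P', hP', hle⟩ := ((hprime P hP).inf_le').1 h
    rw [Finset.mem_erase] at hP'
    exact hP'.1 (hanti P' hP'.2 P hP hle)

variable {K : Type*} [Field K] {d k ℓ : ℕ}

/-- Since the `i_m` form a permutation, reindexing presents `S` as the graph of a nonconstant
function. -/
theorem mem_transversals_iff {S : Finset (Fin k × Fin ℓ)} :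
    S ∈ transversals k ℓ ↔ ∃ c : Fin k → Fin ℓ, (∃ a b, c a ≠ c b) ∧
      ∀ y, y ∈ S ↔ c y.1 = y.2 := by
  classical
  constructor
  · rintro ⟨i, j, hi, hj, rfl⟩
    have hinj : Function.Injective i := by
      have : Set.InjOn i (Finset.univ : Finset (Fin k)) :=
        Finset.card_image_iff.1 (by rw [hi, Finset.card_fin])
      rwa [Finset.coe_univ, Set.injOn_univ] at this
    let π : Equiv.Perm (Fin k) := Equiv.ofBijective i (Finite.injective_iff_bijective.1 hinj)
    have hπ : ∀ m, π.symm (i m) = m := fun m => π.symm_apply_apply m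
    refine ⟨fun m => j (π.symm m), ?_, fun y => ?_⟩
    · obtain ⟨p, hp, q, hq, hpq⟩ := Finset.one_lt_card.1 hj
      obtain ⟨a, -, rfl⟩ := Finset.mem_image.1 hp
      obtain ⟨b, -, rfl⟩ := Finset.mem_image.1 hq
      exact ⟨i a, i b, by simpa only [hπ] using hpq⟩
    · rw [Finset.mem_image]
      constructor
      · rintro ⟨m, -, rfl⟩
        exact congrArg j (hπ m)
      · intro h
        exact ⟨π.symm y.1, Finset.mem_univ _, Prod.ext (π.apply_symm_apply y.1) h⟩
  · rintro ⟨c, ⟨a, b, hab⟩, hS⟩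
    refine ⟨id, c, by simp, Finset.one_lt_card.2 ⟨c a, ?_, c b, ?_, hab⟩, ?_⟩
    · exact Finset.mem_image_of_mem _ (Finset.mem_univ _)
    · exact Finset.mem_image_of_mem _ (Finset.mem_univ _)
    · ext ⟨p, q⟩
      rw [hS, Finset.mem_image]
      simp

theorem colEdges_le_ciEdges :
    hyperedgeIdeal K (Fin d) (colEdges k ℓ 2) ≤ hyperedgeIdeal K (Fin d) (ciEdges k ℓ 2 ℓ) :=
  hyperedgeIdeal_mono Set.subset_union_left

theorem ciEdges_le_idealZero :
    hyperedgeIdeal K (Fin d) (ciEdges k ℓ 2 ℓ) ≤ idealZero K d k ℓ 2 ℓ := by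
  refine hyperedgeIdeal_mono (Set.union_subset_union_right _ ?_)
  refine Set.iUnion_subset fun i B hB => ?_
  exact hB.2

theorem rowMinor_mem (f : Fin ℓ → Fin d) (g : Fin ℓ → Fin k × Fin ℓ) (i : Fin k)
    (hg : ∀ b, (g b).1 = i) :
    ((Matrix.mvPolynomialX (Fin d) (Fin k × Fin ℓ) K).submatrix f g).det ∈
      hyperedgeIdeal K (Fin d) (ciEdges k ℓ 2 ℓ) := by
  refine minor_mem_hyperedgeIdeal f g fun hinj => Or.inr (Set.mem_iUnion.2 ⟨i, fun y hy => ?_, ?_⟩)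
  · obtain ⟨b, -, rfl⟩ := Finset.mem_image.1 hy
    exact Finset.mem_image.2 ⟨(g b).2, Finset.mem_univ _, Prod.ext (hg b).symm rfl⟩
  · rw [Finset.card_image_of_injective _ hinj, Finset.card_fin]

/-- An `ℓ`-subset of a row is the whole row, so it meets `S` and its minors have a column that
vanishes modulo `I_S`. -/
theorem ciEdges_le_idealOf {S : Finset (Fin k × Fin ℓ)} (hS : S ∈ transversals k ℓ) :
    hyperedgeIdeal K (Fin d) (ciEdges k ℓ 2 ℓ) ≤ idealOf K d k ℓ 2 S := by
  classical
  obtain ⟨c, -, hc⟩ := mem_transversals_iff.1 hS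
  refine Ideal.span_le.2 ?_
  rintro _ ⟨n, f, g, hg, rfl⟩
  rcases hg with hg | hg
  · exact Ideal.mem_sup_right (Ideal.subset_span ⟨n, f, g, hg, rfl⟩)
  · obtain ⟨i, hi, hn⟩ := Set.mem_iUnion.1 hg
    have hrow : (rowSet ℓ i).card = ℓ := by
      rw [rowSet, Finset.card_image_of_injective _ (fun a b h => by simpa using h),
        Finset.card_fin]
    have heq := Finset.eq_of_subset_of_card_le hi (by rw [hn, hrow])
    have hmem : (i, c i) ∈ Finset.univ.map g := by
      rw [heq]
      exact Finset.mem_image.2 ⟨c i, Finset.mem_univ _, rfl⟩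
    obtain ⟨b, -, hb⟩ := Finset.mem_map.1 hmem
    rw [idealOf_eq_ker, SetLike.mem_coe, RingHom.mem_ker,
      map_minor _ (fun s => X (Sum.inl s)) (fun y => if y ∈ S then 0 else X (Sum.inr y))]
    · rw [Finset.prod_eq_zero (Finset.mem_univ b), zero_mul]
      rw [if_pos]
      rw [hb, hc]
    · intro s
      rw [AlgHom.comp_apply, aeval_X]
      split_ifs
      · simp
      · exact segreHom_X s

/-- Every prime containing the ideal of the hypergraph contains one of the components. -/
theorem exists_component_le (hk : k ≠ 0)
    {Q : Ideal (MvPolynomial (Fin d × (Fin k × Fin ℓ)) K)}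
    (hQ : Q.IsPrime) (hle : hyperedgeIdeal K (Fin d) (ciEdges k ℓ 2 ℓ) ≤ Q) :
    idealZero K d k ℓ 2 ℓ ≤ Q ∨ ∃ S ∈ transversals k ℓ, idealOf K d k ℓ 2 S ≤ Q := by
  classical
  have hcol := (colEdges_le_ciEdges (K := K) (d := d) (k := k) (ℓ := ℓ)).trans hle
  by_cases hA : ∃ c : Fin k → Fin ℓ, (∃ a b, c a ≠ c b) ∧
      ∀ m x, (X (x, (m, c m)) : MvPolynomial (Fin d × (Fin k × Fin ℓ)) K) ∈ Q
  · obtain ⟨c, hc, hcQ⟩ := hA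
    refine Or.inr ⟨Finset.univ.filter fun y => c y.1 = y.2,
      mem_transversals_iff.2 ⟨c, hc, by simp⟩, sup_le (Ideal.span_le.2 ?_) hcol⟩
    rintro _ ⟨x, ⟨m, j⟩, hy, rfl⟩
    obtain rfl : c m = j := (Finset.mem_filter.1 hy).2
    exact hcQ m x
  refine Or.inl (Ideal.span_le.2 ?_)
  rintro _ ⟨n, f, g, hg, rfl⟩
  rcases hg with hg | hg
  · exact hcol (Ideal.subset_span ⟨n, f, g, hg, rfl⟩)
  rw [allEdges, Set.mem_ofPred_eq, Finset.card_map, Finset.card_fin] at hg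
  subst hg
  by_cases hinj : Function.Injective fun b => (g b).2
  swap
  · exact hcol (minor_mem_of_not_injective f g hinj)
  by_cases hB : ∃ i, ∀ j, ∃ x, (X (x, (i, j)) : MvPolynomial (Fin d × (Fin k × Fin n)) K) ∉ Q
  · obtain ⟨i, hi⟩ := hB
    choose x hx using hi
    let q := Ideal.Quotient.mk Q
    let p : Fin d → Fin k × Fin n → MvPolynomial (Fin d × (Fin k × Fin n)) K ⧸ Q :=
      fun a y => q (X (a, y))
    -- The 2-minors make each column proportional to the row-`i` column of its block, with
    -- multiplier `p (x j) (i, j)` nonzero modulo `Q`.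
    have hrel : ∀ a (y : Fin k × Fin n),
        p (x y.2) (i, y.2) * p a y = p (x y.2) y * p a (i, y.2) := by
      rintro a ⟨i', j⟩
      have := Ideal.Quotient.eq_zero_iff_mem.2 (hcol (two_minor_mem (K := K) (x j) a i' i j))
      rw [map_sub, map_mul, map_mul, sub_eq_zero] at this
      exact this
    have hdet : (∏ b, p (x (g b).2) (i, (g b).2)) * (Matrix.of fun a b => p (f a) (g b)).det =
        (∏ b, p (x (g b).2) (g b)) * (Matrix.of fun a b => p (f a) (i, (g b).2)).det := by
      rw [← Matrix.det_mul_row, ← Matrix.det_mul_row]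
      congr 1
      ext a b
      exact hrel _ _
    have hmap : ∀ h : Fin n → Fin k × Fin n, q ((Matrix.mvPolynomialX (Fin d)
        (Fin k × Fin n) K).submatrix f h).det = (Matrix.of fun a b => p (f a) (h b)).det :=
      fun h => RingHom.map_det _ _
    rw [← hmap g, ← hmap fun b => (i, (g b).2),
      Ideal.Quotient.eq_zero_iff_mem.2 (hle (rowMinor_mem f (fun b => (i, (g b).2)) i fun _ => rfl)),
      mul_zero] at hdet
    refine Ideal.Quotient.eq_zero_iff_mem.1 ((mul_eq_zero.1 hdet).resolve_left ?_)
    refine Finset.prod_ne_zero_iff.2 fun b _ h => ?_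
    exact hx _ (Ideal.Quotient.eq_zero_iff_mem.1 h)
  · push Not at hB hA
    choose c hc using hB
    have hconst : ∀ a b, c a = c b := by
      intro a b
      by_contra hab
      obtain ⟨m, x, hm⟩ := hA c ⟨a, b, hab⟩
      exact hm (hc m x)
    let i₀ : Fin k := ⟨0, Nat.pos_of_ne_zero hk⟩
    obtain ⟨b, hb⟩ := (Finite.injective_iff_surjective.1 hinj) (c i₀)
    refine Ideal.Quotient.eq_zero_iff_mem.1 ?_
    rw [RingHom.map_det]
    refine Matrix.det_eq_zero_of_column_eq_zero b fun a => ?_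
    refine Ideal.Quotient.eq_zero_iff_mem.2 ?_
    have := hc (g b).1 (f a)
    rw [hconst (g b).1 i₀, ← hb] at this
    exact this

theorem X_mem_idealOf_iff {S : Finset (Fin k × Fin ℓ)} (x : Fin d) (y : Fin k × Fin ℓ) :
    X (x, y) ∈ idealOf K d k ℓ 2 S ↔ y ∈ S := by
  constructor
  · rw [idealOf_eq_ker, RingHom.mem_ker, AlgHom.comp_apply, aeval_X]
    intro h
    by_contra hy
    rw [if_neg hy, segreHom_X] at h
    exact mul_ne_zero (X_ne_zero _) (X_ne_zero _) h
  · intro hy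
    exact Ideal.mem_sup_left (Ideal.subset_span ⟨x, y, hy, rfl⟩)

/-- The all-ones matrix is a zero of `I_0` at which no variable vanishes. -/
theorem X_notMem_idealZero (hℓ : 2 ≤ ℓ) (s : Fin d × (Fin k × Fin ℓ)) :
    X s ∉ idealZero K d k ℓ 2 ℓ := by
  let χ : MvPolynomial (Fin d × (Fin k × Fin ℓ)) K →ₐ[K] K := aeval 1
  have hχ : ∀ s, χ (X s) = 1 * 1 := fun s => by simp [χ]
  have hle : idealZero K d k ℓ 2 ℓ ≤ RingHom.ker χ := by
    refine Ideal.span_le.2 ?_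
    rintro _ ⟨n, f, g, hg, rfl⟩
    rcases hg with hg | hg
    · exact hyperedgeIdeal_colEdges_le_ker χ 1 1 hχ (Ideal.subset_span ⟨n, f, g, hg, rfl⟩)
    · rw [allEdges, Set.mem_ofPred_eq, Finset.card_map, Finset.card_fin] at hg
      subst hg
      rw [SetLike.mem_coe, RingHom.mem_ker, map_minor χ 1 1 hχ,
        Matrix.det_zero_of_column_eq (i := ⟨0, by omega⟩) (j := ⟨1, by omega⟩)
          (by simp [Fin.ext_iff]) (fun _ => rfl), mul_zero]
  intro h
  simpa [χ] using (RingHom.mem_ker).1 (hle h)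

/-- As `c` is nonconstant, every block `j` has a column `(e j, j)` outside `S`. Putting the `j`-th
unit vector there and zero elsewhere gives a zero of `I_S` with an `ℓ`-minor equal to one. -/
theorem not_idealZero_le_idealOf (hld : ℓ ≤ d) {S : Finset (Fin k × Fin ℓ)}
    (hS : S ∈ transversals k ℓ) : ¬ idealZero K d k ℓ 2 ℓ ≤ idealOf K d k ℓ 2 S := by
  classical
  obtain ⟨c, ⟨a, b, hab⟩, hc⟩ := mem_transversals_iff.1 hS
  have he : ∀ j, ∃ e, c e ≠ j := fun j => by
    by_contra! H
    exact hab ((H a).trans (H b).symm)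
  choose e he using he
  let v : Fin d × Fin ℓ → K := fun s => if s.1 = Fin.castLE hld s.2 then 1 else 0
  let w : Fin k × Fin ℓ → K := fun y => if y.1 = e y.2 then 1 else 0
  let χ : MvPolynomial (Fin d × (Fin k × Fin ℓ)) K →ₐ[K] K :=
    aeval fun s => v (s.1, s.2.2) * w s.2
  have hχ : ∀ s, χ (X s) = v (s.1, s.2.2) * w s.2 := fun s => by simp only [χ, aeval_X]
  have hle : idealOf K d k ℓ 2 S ≤ RingHom.ker χ := by
    refine sup_le (Ideal.span_le.2 ?_) (hyperedgeIdeal_colEdges_le_ker χ v w hχ)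
    rintro _ ⟨x, y, hy, rfl⟩
    rw [SetLike.mem_coe, RingHom.mem_ker, hχ]
    have : y.1 ≠ e y.2 := fun h => he y.2 (h ▸ (hc y).1 hy)
    simp only [w, if_neg this, mul_zero]
  intro H
  have h := (RingHom.mem_ker).1 (hle (H (minor_mem_idealZero (Fin.castLE hld) fun j => (e j, j))))
  rw [map_minor χ v w hχ] at h
  have h1 : (Matrix.of fun a b : Fin ℓ => v (Fin.castLE hld a, b)) = 1 := by
    ext a b
    simp [v, Matrix.one_apply]
  simp [w, h1] at h

end Decomposition

end HyperedgeIdeal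

end

open HyperedgeIdeal in
theorem theorem2p6 (K : Type*) [Field K] (d k ℓ : ℕ) (hk : 2 ≤ k) (hkl : k ≤ ℓ) (hld : ℓ ≤ d) :
    -- the decomposition of the radical
    (HyperedgeIdeal.hyperedgeIdeal K (Fin d) (HyperedgeIdeal.ciEdges k ℓ 2 ℓ)).radical =
        HyperedgeIdeal.idealZero K d k ℓ 2 ℓ ⊓
          ⨅ S ∈ HyperedgeIdeal.transversals k ℓ, HyperedgeIdeal.idealOf K d k ℓ 2 S ∧
    -- its components are prime
    (HyperedgeIdeal.idealZero K d k ℓ 2 ℓ).IsPrime ∧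
    (∀ S ∈ HyperedgeIdeal.transversals k ℓ, (HyperedgeIdeal.idealOf K d k ℓ 2 S).IsPrime) ∧
    -- no component is listed twice
    Set.InjOn (HyperedgeIdeal.idealOf K d k ℓ 2) (HyperedgeIdeal.transversals k ℓ) ∧
    (∀ S ∈ HyperedgeIdeal.transversals k ℓ,
      HyperedgeIdeal.idealOf K d k ℓ 2 S ≠ HyperedgeIdeal.idealZero K d k ℓ 2 ℓ) ∧
    -- it is a minimal primary decomposition
    (∃ t : Finset (Ideal (MvPolynomial (Fin d × (Fin k × Fin ℓ)) K)),
      (t : Set (Ideal (MvPolynomial (Fin d × (Fin k × Fin ℓ)) K))) =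
          insert (HyperedgeIdeal.idealZero K d k ℓ 2 ℓ)
            (HyperedgeIdeal.idealOf K d k ℓ 2 '' HyperedgeIdeal.transversals k ℓ) ∧
        Submodule.IsMinimalPrimaryDecomposition
          (HyperedgeIdeal.hyperedgeIdeal K (Fin d) (HyperedgeIdeal.ciEdges k ℓ 2 ℓ)).radical t) ∧
    -- its components are the minimal primes of the hyperedge ideal
    (HyperedgeIdeal.hyperedgeIdeal K (Fin d) (HyperedgeIdeal.ciEdges k ℓ 2 ℓ)).minimalPrimes =
      insert (HyperedgeIdeal.idealZero K d k ℓ 2 ℓ)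
        (HyperedgeIdeal.idealOf K d k ℓ 2 '' HyperedgeIdeal.transversals k ℓ) := by

  classical
  have h0 : (idealZero K d k ℓ 2 ℓ).IsPrime := idealZero_isPrime (by omega)
  have hS0 : ∀ S ∈ transversals k ℓ, ¬ idealOf K d k ℓ 2 S ≤ idealZero K d k ℓ 2 ℓ := by
    intro S hS h
    obtain ⟨c, -, hc⟩ := mem_transversals_iff.1 hS
    exact X_notMem_idealZero (by omega) _ (h ((X_mem_idealOf_iff (⟨0, by omega⟩ : Fin d)
      ((⟨0, by omega⟩ : Fin k), c ⟨0, by omega⟩)).2 ((hc _).2 rfl)))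
  have hSS : ∀ S ∈ transversals k ℓ, ∀ T ∈ transversals k ℓ,
      idealOf K d k ℓ 2 S ≤ idealOf K d k ℓ 2 T → S = T := by
    intro S hS T hT h
    obtain ⟨c, -, hc⟩ := mem_transversals_iff.1 hS
    obtain ⟨c', -, hc'⟩ := mem_transversals_iff.1 hT
    have hcc : c = c' := by
      ext1 m
      have hm := (X_mem_idealOf_iff (⟨0, by omega⟩ : Fin d) (m, c m)).1
        (h ((X_mem_idealOf_iff _ _).2 ((hc (m, c m)).2 rfl)))
      exact ((hc' _).1 hm).symm
    ext y
    rw [hc, hc', hcc]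
  set A : Set (Ideal (MvPolynomial (Fin d × (Fin k × Fin ℓ)) K)) :=
    insert (idealZero K d k ℓ 2 ℓ) (idealOf K d k ℓ 2 '' transversals k ℓ) with hA
  have hAprime : ∀ P ∈ A, P.IsPrime := by
    rintro P (rfl | ⟨S, -, rfl⟩)
    exacts [h0, idealOf_isPrime S]
  have hAanti : ∀ P ∈ A, ∀ P' ∈ A, P ≤ P' → P = P' := by
    rintro P (rfl | ⟨S, hS, rfl⟩) P' (rfl | ⟨T, hT, rfl⟩) h
    · rfl
    · exact absurd h (not_idealZero_le_idealOf hld hT)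
    · exact absurd h (hS0 S hS)
    · rw [hSS S hS T hT h]
  have hmin : (hyperedgeIdeal K (Fin d) (ciEdges k ℓ 2 ℓ)).minimalPrimes = A := by
    refine minimalPrimes_eq_of_antichain hAprime ?_ ?_ hAanti
    · rintro P (rfl | ⟨S, hS, rfl⟩)
      exacts [ciEdges_le_idealZero, ciEdges_le_idealOf hS]
    · intro Q hQ hle
      rcases exists_component_le (by omega) hQ hle with h | ⟨S, hS, h⟩
      · exact ⟨_, Or.inl rfl, h⟩
      · exact ⟨_, Or.inr ⟨S, hS, rfl⟩, h⟩
  have hfin : A.Finite := ((Set.toFinite _).image _).insert _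
  refine ⟨?_, h0, fun S _ => idealOf_isPrime S, fun S hS T hT h => hSS S hS T hT h.le,
    fun S hS h => hS0 S hS h.le, ⟨hfin.toFinset, hfin.coe_toFinset, ?_⟩, hmin⟩
  · rw [← Ideal.sInf_minimalPrimes, hmin, sInf_insert, sInf_image]
  · refine isMinimalPrimaryDecomposition_of_antichain ?_ (by simpa using hAprime)
      (by simpa using hAanti)
    rw [← Ideal.sInf_minimalPrimes, hmin, Finset.inf_id_eq_sInf, hfin.coe_toFinset]
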